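/- For $\lambda>3$ let $\mu_\lambda$ be the Pareto probability measure on $\mathbb{R}$ with density $(\lambda-1)x^{-\lambda}$ on $[1,\infty)$ (and $0$ elsewhere), and let $\mu_\lambda^n$ be its $n$-fold product on $\mathbb{R}^n$. Let $\operatorname{Lip}_1(\mathbb{R}^n)$ be the set of functions $f:\mathbb{R}^n\to\mathbb{R}$ with $|f(x)-f(y)|\le |x-y|_2$ for all $x,y\in\mathbb{R}^n$, where $|\cdot|_2$ is the Euclidean norm. Fix $\lambda>3$. Then for every $n\ge 1$ every $f\in\operatorname{Lip}_1(\mathbb{R}^n)$ is square-integrable with respect to $\mu_\lambda^n$ and satisfies $$\operatorname{Var}_{\mu_\lambda^n}(f)\le C(\lambda)\,n^{\frac{2}{\lambda-1}},\qquad C(\lambda)=2^{\frac{6\lambda-16}{\lambda-1}}\,(\lambda-1)^{-\frac{2\lambda-6}{\lambda}}\left(\frac{4}{\lambda-3}\right)^{\frac{2}{\lambda-1}}.$$ Moreover, as $n\to\infty$ with $\lambda$ fixed, $$\sup_{f\in\operatorname{Lip}_1(\mathbb{R}^n)}\operatorname{Var}_{\mu_\lambda^n}(f)=\Theta\!\left(n^{\frac{2}{\lambda-1}}\right),$$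 where the supremum is finite for every $n\ge1$. The lower bound is already attained, up to a constant, by the maximum function $x\mapsto\max\{x_1,\dots,x_n\}$: it belongs to $\operatorname{Lip}_1(\mathbb{R}^n)$ for every $n\ge1$, and $\operatorname{Var}_{\mu_\lambda^n}(\max\{x_1,\dots,x_n\})=\Theta\!\left(n^{\frac{2}{\lambda-1}}\right)$ as $n\to\infty$. -/

import Mathlib

open MeasureTheory ProbabilityTheory Filter Asymptotics

/-- The product measure `μ_λⁿ` on Euclidean space `ℝⁿ`. The marginal `paretoMeasure 1 (lam - 1)` is
the Pareto measure `μ_λ`, with density `(λ - 1) * x ^ (-λ)` on `[1, ∞)`. -/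
noncomputable def paretoProd (lam : ℝ) (n : ℕ) : Measure (EuclideanSpace ℝ (Fin n)) :=
  (Measure.pi fun _ : Fin n => paretoMeasure 1 (lam - 1)).map (WithLp.toLp 2)

/-- The explicit constant `C(λ)`. -/
noncomputable def paretoConst (lam : ℝ) : ℝ :=
  2 ^ ((6 * lam - 16) / (lam - 1)) * (lam - 1) ^ (-((2 * lam - 6) / lam)) *
    (4 / (lam - 3)) ^ (2 / (lam - 1))

/-- The set `Lip₁(ℝⁿ)` of real functions that are 1-Lipschitz for the Euclidean distance. -/
def lipOne (n : ℕ) : Set (EuclideanSpace ℝ (Fin n) → ℝ) := {f | LipschitzWith 1 f}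

/-- The maximum function `x ↦ max {x₁, …, xₙ}` (the value is `0` when `n = 0`). -/
noncomputable def maxCoord (n : ℕ) (x : EuclideanSpace ℝ (Fin n)) : ℝ := ⨆ i, x i

/-! Write `a = lam - 1 > 2`. On the line, the Pareto measure satisfies Var g ≤ (4/a²) ∫ x² g'²
(`variance_paretoMeasure_one_le`): integrate the derivative of x^(-a) (g - g(1))² and complete a
square. Efron–Stein tensorizes this with the same constant (`variance_pi_le_of_variance_le`), giving
Var f ≤ (4/a²) ∑ ∫ xᵢ² (∂ᵢf)².

For f 1-Lipschitz, ∑ (∂ᵢf)² ≤ 1 almost everywhere. Hence for any s the sum of xᵢ² (∂ᵢf)² is at most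
s² + ∑ (xᵢ² - s²)₊, whose mean for s ≥ 1 is s² + 2n s^(2-a)/(a-2). The choice s = n^(1/a) balances
the two terms and gives the constant 4/(a(a-2)), which is below `paretoConst`.

For the lower bound, the maximum has distribution function (1 - t^(-a))^n on t ≥ 1. At scale s =
n^(1/a) it falls below s, and above 2s, with probability bounded away from 0, so its variance is at
least of order s² (`mul_sq_le_variance_of_gap`). -/

/-! ### Efron–Stein inequality for two factors -/

/-- The integral of a square-integrable function over one factor is square-integrable, and the
variances of its sections integrate to the difference of the second moments. -/
theorem memLp_and_integral_variance_section {α β : Type*} [MeasurableSpace α] [MeasurableSpace β]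
    {μ : Measure α} {ν : Measure β} [IsProbabilityMeasure μ] [IsProbabilityMeasure ν]
    {f : α × β → ℝ} (hf : MemLp f 2 (μ.prod ν)) :
    MemLp (fun x => ∫ y, f (x, y) ∂ν) 2 μ ∧
      Integrable (fun x => Var[fun y => f (x, y); ν]) μ ∧
      ∫ x, Var[fun y => f (x, y); ν] ∂μ =
        ∫ z, f z ^ 2 ∂(μ.prod ν) - ∫ x, (∫ y, f (x, y) ∂ν) ^ 2 ∂μ := by
  have hsq : Integrable (fun z => f z ^ 2) (μ.prod ν) := hf.integrable_sq
  have hsec : ∀ᵐ x ∂μ, MemLp (fun y => f (x, y)) 2 ν := by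
    filter_upwards [hsq.prod_right_ae, hf.1.prodMk_left] with x h1 h2
    exact (memLp_two_iff_integrable_sq h2).2 h1
  have hvar : ∀ᵐ x ∂μ, Var[fun y => f (x, y); ν] =
      ∫ y, f (x, y) ^ 2 ∂ν - (∫ y, f (x, y) ∂ν) ^ 2 := by
    filter_upwards [hsec] with x hx
    simpa using variance_eq_sub hx
  have hm : AEStronglyMeasurable (fun x => ∫ y, f (x, y) ∂ν) μ := hf.1.integral_prod_right'
  have hA2 : Integrable (fun x => (∫ y, f (x, y) ∂ν) ^ 2) μ := by
    -- Nonnegativity of the variance of a section plays the role of Jensen's inequality.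
    refine hsq.integral_prod_left.mono' (hm.pow 2) ?_
    filter_upwards [hvar] with x hx
    have := variance_nonneg (fun y => f (x, y)) ν
    rw [Real.norm_of_nonneg (sq_nonneg _)]
    linarith
  refine ⟨(memLp_two_iff_integrable_sq hm).2 hA2,
    (hsq.integral_prod_left.sub hA2).congr (hvar.mono fun x hx => hx.symm), ?_⟩
  rw [integral_congr_ae hvar, integral_sub hsq.integral_prod_left hA2, integral_prod _ hsq]

/-- The second moments of the two partial integrals of a square-integrable function are jointly
bounded by its second moment and its squared mean. -/
theorem integral_sq_add_integral_sq_le {α β : Type*} [MeasurableSpace α] [MeasurableSpace β]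
    {μ : Measure α} {ν : Measure β} [IsProbabilityMeasure μ] [IsProbabilityMeasure ν]
    {f : α × β → ℝ} (hf : MemLp f 2 (μ.prod ν)) :
    ∫ x, (∫ y, f (x, y) ∂ν) ^ 2 ∂μ + ∫ y, (∫ x, f (x, y) ∂μ) ^ 2 ∂ν ≤
      ∫ z, f z ^ 2 ∂(μ.prod ν) + (∫ z, f z ∂(μ.prod ν)) ^ 2 := by
  set A : α → ℝ := fun x => ∫ y, f (x, y) ∂ν with hA
  set B : β → ℝ := fun y => ∫ x, f (x, y) ∂μ with hB
  set m : ℝ := ∫ z, f z ∂(μ.prod ν) with hm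
  have hAm : MemLp A 2 μ := (memLp_and_integral_variance_section hf).1
  have hfs : MemLp (fun z : β × α => f z.swap) 2 (ν.prod μ) :=
    hf.comp_measurePreserving Measure.measurePreserving_swap
  have hBm : MemLp B 2 ν := (memLp_and_integral_variance_section hfs).1
  have hA' : MemLp (fun z : α × β => A z.1) 2 (μ.prod ν) :=
    hAm.comp_measurePreserving measurePreserving_fst
  have hB' : MemLp (fun z : α × β => B z.2) 2 (μ.prod ν) :=
    hBm.comp_measurePreserving measurePreserving_snd
  have hf1 : Integrable f (μ.prod ν) := hf.integrable (by norm_num)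
  have iA : ∫ x, A x ∂μ = m := (integral_prod f hf1).symm
  have iB : ∫ y, B y ∂ν = m := (integral_prod_symm f hf1).symm
  have i1 : ∫ z, f z * A z.1 ∂(μ.prod ν) = ∫ x, A x ^ 2 ∂μ := by
    rw [integral_prod (fun z => f z * A z.1) (hf.integrable_mul hA')]
    simp only [integral_mul_const, sq, hA]
  have i2 : ∫ z, f z * B z.2 ∂(μ.prod ν) = ∫ y, B y ^ 2 ∂ν := by
    rw [integral_prod_symm (fun z => f z * B z.2) (hf.integrable_mul hB')]
    simp only [integral_mul_const, sq, hB]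
  have i3 : ∫ z, A z.1 * B z.2 ∂(μ.prod ν) = m ^ 2 := by
    rw [integral_prod_mul, iA, iB, sq]
  have i4 : ∫ z, A z.1 ^ 2 ∂(μ.prod ν) = ∫ x, A x ^ 2 ∂μ := by
    rw [integral_prod _ hA'.integrable_sq]; simp
  have i5 : ∫ z, B z.2 ^ 2 ∂(μ.prod ν) = ∫ x, B x ^ 2 ∂ν := by
    rw [integral_prod _ hB'.integrable_sq]; simp
  -- The function f - A - B has mean -m and nonnegative variance. By `i1`–`i5` its second moment is
  -- ∫ f² - ∫ A² - ∫ B² + 2m², which is the claim.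
  have h0 : m ^ 2 ≤ ∫ z, (f z - A z.1 - B z.2) ^ 2 ∂(μ.prod ν) := by
    have hv := variance_eq_sub ((hf.sub hA').sub hB')
    have hv0 := variance_nonneg (f - (fun z : α × β => A z.1) - fun z => B z.2) (μ.prod ν)
    have hi : ∫ z, (f z - A z.1 - B z.2) ∂(μ.prod ν) = -m := by
      have kA : Integrable (fun z : α × β => A z.1) (μ.prod ν) := hA'.integrable (by norm_num)
      have kB : Integrable (fun z : α × β => B z.2) (μ.prod ν) := hB'.integrable (by norm_num)
      rw [integral_sub (by exact hf1.sub kA) kB, integral_sub hf1 kA, integral_prod _ kA,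
        integral_prod _ kB]
      simp [iA, iB, ← hm]
    simp only [Pi.sub_apply, Pi.pow_apply, hi] at hv
    linarith [neg_sq m]
  have e : ∫ z, (f z - A z.1 - B z.2) ^ 2 ∂(μ.prod ν) =
      ∫ z, f z ^ 2 ∂(μ.prod ν) + ∫ z, A z.1 ^ 2 ∂(μ.prod ν) + ∫ z, B z.2 ^ 2 ∂(μ.prod ν)
        + 2 * ∫ z, A z.1 * B z.2 ∂(μ.prod ν) - 2 * ∫ z, f z * A z.1 ∂(μ.prod ν)
        - 2 * ∫ z, f z * B z.2 ∂(μ.prod ν) := by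
    have j1 := hf.integrable_sq
    have j2 := hA'.integrable_sq
    have j3 := hB'.integrable_sq
    have j4 : Integrable (fun z : α × β => A z.1 * B z.2) (μ.prod ν) := hA'.integrable_mul hB'
    have j5 : Integrable (fun z : α × β => f z * A z.1) (μ.prod ν) := hf.integrable_mul hA'
    have j6 : Integrable (fun z : α × β => f z * B z.2) (μ.prod ν) := hf.integrable_mul hB'
    rw [← integral_const_mul, ← integral_const_mul, ← integral_const_mul, ← integral_add j1 j2,
      ← integral_add (by exact j1.add j2) j3,
      ← integral_add (by exact (j1.add j2).add j3) (j4.const_mul 2),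
      ← integral_sub (by exact ((j1.add j2).add j3).add (j4.const_mul 2)) (j5.const_mul 2),
      ← integral_sub (by exact (((j1.add j2).add j3).add (j4.const_mul 2)).sub (j5.const_mul 2))
        (j6.const_mul 2)]
    exact integral_congr_ae (ae_of_all _ fun z => by ring)
  rw [e, i1, i2, i3, i4, i5] at h0
  change ∫ x, A x ^ 2 ∂μ + ∫ y, B y ^ 2 ∂ν ≤ _
  linarith

/-- The Efron–Stein inequality for a product of two probability spaces. -/
theorem variance_prod_le {α β : Type*} [MeasurableSpace α] [MeasurableSpace β]
    {μ : Measure α} {ν : Measure β} [IsProbabilityMeasure μ] [IsProbabilityMeasure ν]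
    {f : α × β → ℝ} (hf : MemLp f 2 (μ.prod ν)) :
    Var[f; μ.prod ν] ≤
      ∫ y, Var[fun x => f (x, y); μ] ∂ν + ∫ x, Var[fun y => f (x, y); ν] ∂μ := by
  have hfs : MemLp (fun z : β × α => f z.swap) 2 (ν.prod μ) :=
    hf.comp_measurePreserving Measure.measurePreserving_swap
  have h1 := (memLp_and_integral_variance_section hf).2.2
  have h2 := (memLp_and_integral_variance_section hfs).2.2
  have h3 := integral_sq_add_integral_sq_le hf
  have h4 : ∫ z : β × α, f z.swap ^ 2 ∂(ν.prod μ) = ∫ z, f z ^ 2 ∂(μ.prod ν) :=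
    integral_prod_swap (fun z => f z ^ 2)
  have h5 := variance_eq_sub hf
  simp only [Prod.swap_prod_mk, Pi.pow_apply] at h2 h5
  rw [h1, h2, h4, h5]
  linarith

/-! ### Integrals against the Pareto measure -/

theorem measurable_paretoPDF (t a : ℝ) : Measurable (paretoPDF t a) :=
  (measurable_paretoPDFReal t a).ennreal_ofReal

theorem integral_paretoMeasure_one {a : ℝ} (ha : 0 < a) (g : ℝ → ℝ) :
    ∫ x, g x ∂(paretoMeasure 1 a) = ∫ x in Set.Ioi 1, a * x ^ (-(a + 1)) * g x := by
  rw [paretoMeasure, integral_withDensity_eq_integral_toReal_smul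
    (measurable_paretoPDF 1 a) (ae_of_all _ fun x => ENNReal.ofReal_lt_top),
    ← integral_Ici_eq_integral_Ioi, ← integral_indicator measurableSet_Ici]
  congr 1 with x
  rw [paretoPDF, ENNReal.toReal_ofReal (paretoPDFReal_nonneg zero_le_one ha.le x), paretoPDFReal]
  by_cases hx : 1 ≤ x <;> simp [hx]

theorem integrable_paretoMeasure_one_iff {a : ℝ} (ha : 0 < a) {g : ℝ → ℝ} :
    Integrable g (paretoMeasure 1 a) ↔
      IntegrableOn (fun x => a * x ^ (-(a + 1)) * g x) (Set.Ioi 1) := by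
  rw [paretoMeasure, integrable_withDensity_iff_integrable_smul'
    (measurable_paretoPDF 1 a) (ae_of_all _ fun x => ENNReal.ofReal_lt_top),
    ← integrableOn_Ici_iff_integrableOn_Ioi, ← integrable_indicator_iff measurableSet_Ici]
  congr! 1 with x
  ext x
  rw [paretoPDF, ENNReal.toReal_ofReal (paretoPDFReal_nonneg zero_le_one ha.le x), paretoPDFReal]
  by_cases hx : 1 ≤ x <;> simp [hx]

theorem paretoMeasure_absolutelyContinuous (t a : ℝ) : paretoMeasure t a ≪ volume :=
  withDensity_absolutelyContinuous _ _

theorem memLp_id_paretoMeasure_one {a : ℝ} (ha : 2 < a) :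
    MemLp (fun x : ℝ => x) 2 (paretoMeasure 1 a) := by
  refine (memLp_two_iff_integrable_sq (by fun_prop)).2 ?_
  rw [integrable_paretoMeasure_one_iff (by linarith)]
  refine IntegrableOn.congr_fun (f := fun x => a * x ^ (1 - a))
    ((integrableOn_Ioi_rpow_of_lt (by linarith) one_pos).const_mul a)
    (fun x (hx : 1 < x) => ?_) measurableSet_Ioi
  have hx0 : 0 < x := by linarith
  simp only
  rw [mul_assoc, ← Real.rpow_natCast, ← Real.rpow_add hx0]
  congr 2; push_cast; ring

/-- The mean cost per coordinate of truncating x² at level s². -/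
theorem integral_sq_sub_sq_pos_part_paretoMeasure_one {a s : ℝ} (ha : 2 < a) (hs : 1 ≤ s) :
    ∫ x, max (x ^ 2 - s ^ 2) 0 ∂(paretoMeasure 1 a) = 2 * s ^ (2 - a) / (a - 2) := by
  have hs0 : 0 < s := by linarith
  rw [integral_paretoMeasure_one (by linarith)]
  have h1 : ∫ x in Set.Ioi 1, a * x ^ (-(a + 1)) * max (x ^ 2 - s ^ 2) 0 =
      ∫ x in Set.Ioi s, (a * x ^ (1 - a) - a * s ^ 2 * x ^ (-(a + 1))) := by
    rw [← integral_indicator measurableSet_Ioi, ← integral_indicator measurableSet_Ioi]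
    congr 1 with x
    by_cases hx : s < x
    · have hx1 : 1 < x := by linarith
      have hx0 : 0 < x := by linarith
      have e : x ^ (1 - a) = x ^ (-(a + 1)) * x ^ 2 := by
        rw [← Real.rpow_natCast, ← Real.rpow_add hx0]
        congr 1; push_cast; ring
      rw [Set.indicator_of_mem (by exact hx1), Set.indicator_of_mem (by exact hx),
        max_eq_left (by nlinarith), e]
      ring
    · rw [Set.indicator_of_notMem (s := Set.Ioi s) (by exact hx)]
      by_cases hx1 : 1 < x
      · rw [Set.indicator_of_mem (by exact hx1), max_eq_right (by nlinarith), mul_zero]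
      · rw [Set.indicator_of_notMem (by exact hx1)]
  rw [h1, integral_sub, integral_const_mul, integral_const_mul,
    integral_Ioi_rpow_of_lt (by linarith) hs0, integral_Ioi_rpow_of_lt (by linarith) hs0]
  · have e1 : 1 - a + 1 = 2 - a := by ring
    have e2 : -(a + 1) + 1 = -a := by ring
    have e3 : s ^ (2 - a) = s ^ 2 * s ^ (-a) := by
      rw [← Real.rpow_natCast, ← Real.rpow_add hs0]
      congr 1
    rw [e1, e2, e3]
    have h2 : a - 2 ≠ 0 := by linarith
    have h3 : 2 - a ≠ 0 := by linarith
    have h4 : a ≠ 0 := by linarith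
    field_simp
    ring
  · exact (integrableOn_Ioi_rpow_of_lt (by linarith) hs0).const_mul _
  · exact (integrableOn_Ioi_rpow_of_lt (by linarith) hs0).const_mul _

theorem paretoMeasure_one_real_Iic {a t : ℝ} (ha : 0 < a) (ht : 1 ≤ t) :
    (paretoMeasure 1 a).real (Set.Iic t) = 1 - t ^ (-a) := by
  have := isProbabilityMeasure_paretoMeasure one_pos ha
  have ht0 : 0 < t := by linarith
  have h : (paretoMeasure 1 a).real (Set.Ioi t) = t ^ (-a) := by
    rw [← integral_indicator_one measurableSet_Ioi, integral_paretoMeasure_one ha]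
    have h1 : ∫ x in Set.Ioi 1, a * x ^ (-(a + 1)) * (Set.Ioi t).indicator 1 x =
        ∫ x in Set.Ioi t, a * x ^ (-(a + 1)) := by
      rw [← integral_indicator measurableSet_Ioi, ← integral_indicator measurableSet_Ioi]
      congr 1 with x
      by_cases hx : t < x
      · simp [hx, ht.trans_lt hx]
      · simp [hx]
    rw [h1, integral_const_mul, integral_Ioi_rpow_of_lt (by linarith) ht0]
    have e2 : -(a + 1) + 1 = -a := by ring
    rw [e2]
    field_simp
  rw [← h, ← Set.compl_Ioi, probReal_compl_eq_one_sub measurableSet_Ioi]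

/-! ### Weighted Poincaré inequality on the line -/

/-- Weighted Poincaré inequality for the Pareto measure and Lipschitz functions. -/
theorem variance_paretoMeasure_one_le {a : ℝ} (ha : 2 < a) {g : ℝ → ℝ} {K : NNReal}
    (hg : LipschitzWith K g) :
    Var[g; paretoMeasure 1 a] ≤ 4 / a ^ 2 * ∫ x, x ^ 2 * deriv g x ^ 2 ∂(paretoMeasure 1 a) := by
  have ha0 : 0 < a := by linarith
  have := isProbabilityMeasure_paretoMeasure one_pos ha0
  set h : ℝ → ℝ := fun x => g x - g 1 with hh
  have hL : LipschitzWith K h := by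
    simpa using hg.sub (LipschitzWith.const (g 1))
  have hd : deriv h = deriv g := by
    ext x; simp [hh]
  have hdb : ∀ x, |deriv g x| ≤ K := fun x => norm_deriv_le_of_lipschitz hg
  have hhb : ∀ x, |h x| ≤ K * |x - 1| := fun x => by
    simpa [Real.dist_eq, hh] using hg.dist_le_mul x 1
  have hx2 : MemLp (fun x : ℝ => x) 2 (paretoMeasure 1 a) := memLp_id_paretoMeasure_one ha
  have i1 : Integrable (fun x => x ^ 2 * deriv g x ^ 2) (paretoMeasure 1 a) := by
    refine (hx2.integrable_sq.mul_const ((K : ℝ) ^ 2)).mono'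
      (((measurable_id.pow_const 2).mul ((measurable_deriv g).pow_const 2)).aestronglyMeasurable)
      (ae_of_all _ fun x => ?_)
    rw [Real.norm_of_nonneg (by positivity)]
    refine mul_le_mul_of_nonneg_left ?_ (sq_nonneg x)
    rw [← sq_abs]
    exact pow_le_pow_left₀ (abs_nonneg _) (hdb x) 2
  have i2 : Integrable (fun x => h x ^ 2) (paretoMeasure 1 a) := by
    have : MemLp (fun x : ℝ => (K : ℝ) * (x - 1)) 2 (paretoMeasure 1 a) :=
      (hx2.sub (memLp_const 1)).const_mul _
    refine this.integrable_sq.mono' (by have := hL.continuous; fun_prop) (ae_of_all _ fun x => ?_)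
    rw [Real.norm_of_nonneg (by positivity), ← sq_abs, ← sq_abs (_ * _), abs_mul, NNReal.abs_eq]
    gcongr
    exact hhb x
  -- The inequality for h is equivalent to ∫ G ≥ 0. Against the density, G dominates the derivative
  -- of x^(-a) h², whose integral over [1, b] is b^(-a) h(b)² ≥ 0 because h(1) = 0.
  set G : ℝ → ℝ := fun x => 2 / a ^ 2 * (x ^ 2 * deriv g x ^ 2) - h x ^ 2 / 2 with hG
  have iG : Integrable G (paretoMeasure 1 a) := (i1.const_mul _).sub (i2.div_const 2)
  have hmain : 0 ≤ ∫ x, G x ∂(paretoMeasure 1 a) := by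
    rw [integral_paretoMeasure_one ha0]
    have iG' := (integrable_paretoMeasure_one_iff ha0).1 iG
    refine ge_of_tendsto (intervalIntegral_tendsto_integral_Ioi 1 iG' tendsto_id) ?_
    filter_upwards [eventually_ge_atTop 1] with b hb
    have hpos : ∀ x ∈ Set.uIcc 1 b, 0 < x := fun x hx => by
      rw [Set.uIcc_of_le hb] at hx; linarith [hx.1]
    -- Since h is only Lipschitz, the fundamental theorem of calculus is used in its absolutely
    -- continuous form.
    have ac1 : AbsolutelyContinuousOnInterval (fun x : ℝ => x ^ (-a)) 1 b := by
      refine ContDiffOn.absolutelyContinuousOnInterval fun x hx => ?_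
      exact (Real.contDiffAt_rpow_const_of_ne (hpos x hx).ne').contDiffWithinAt
    have ac2 : AbsolutelyContinuousOnInterval h 1 b :=
      (hL.lipschitzOnWith).absolutelyContinuousOnInterval
    have ac := ac1.fun_mul (ac2.fun_mul ac2)
    have hFTC := ac.integral_deriv_eq_sub
    have h1 : h 1 = 0 := by simp [hh]
    have hnn : 0 ≤ ∫ x in (1 : ℝ)..b, deriv (fun x => x ^ (-a) * (h x * h x)) x := by
      rw [hFTC, h1]
      have := Real.rpow_nonneg (zero_le_one.trans hb) (-a)
      simp only [mul_zero, sub_zero]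
      exact mul_nonneg this (mul_self_nonneg _)
    refine hnn.trans (intervalIntegral.integral_mono_ae_restrict hb ac.intervalIntegrable_deriv
      ((intervalIntegrable_iff_integrableOn_Ioc_of_le hb).2
        (iG'.mono_set Set.Ioc_subset_Ioi_self)) ?_)
    rw [EventuallyLE, ae_restrict_iff' measurableSet_Icc]
    filter_upwards [ac2.ae_differentiableAt] with x hx hxm
    rw [← Set.uIcc_of_le hb] at hxm
    have hx0 := hpos x hxm
    have hD := (hx hxm).hasDerivAt
    have hF := ((Real.hasDerivAt_rpow_const (p := -a) (Or.inl hx0.ne')).mul (hD.mul hD)).deriv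
    have e1 : x ^ (-a) = x ^ (-(a + 1)) * x := by
      rw [← Real.rpow_add_one hx0.ne']; congr 1; ring
    have e2 : -a - 1 = -(a + 1) := by ring
    have hF' : deriv (fun x => x ^ (-a) * (h x * h x)) x =
      -a * x ^ (-(a + 1)) * (h x * h x) + x ^ (-(a + 1)) * x *
        (deriv g x * h x + h x * deriv g x) := by
      rw [← e2] at e1 ⊢
      rw [← e1, ← hd]
      exact hF
    rw [hF', hG]
    have hw : 0 < x ^ (-(a + 1)) := Real.rpow_pos_of_pos hx0 _
    have key : a * x ^ (-(a + 1)) * (2 / a ^ 2 * (x ^ 2 * deriv g x ^ 2) - h x ^ 2 / 2) -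
        (-a * x ^ (-(a + 1)) * (h x * h x) + x ^ (-(a + 1)) * x *
        (deriv g x * h x + h x * deriv g x)) =
        a * x ^ (-(a + 1)) / 2 * (h x - 2 / a * x * deriv g x) ^ 2 := by
      field_simp
      ring
    have : 0 ≤ a * x ^ (-(a + 1)) / 2 * (h x - 2 / a * x * deriv g x) ^ 2 := by positivity
    simp only
    linarith
  rw [hG, integral_sub (i1.const_mul _) (i2.div_const 2), integral_const_mul,
    integral_div] at hmain
  have hgm : AEStronglyMeasurable g (paretoMeasure 1 a) := hg.continuous.aestronglyMeasurable
  calc Var[g; paretoMeasure 1 a] = Var[h; paretoMeasure 1 a] := (variance_sub_const hgm _).symm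
    _ ≤ ∫ x, h x ^ 2 ∂(paretoMeasure 1 a) :=
      variance_le_expectation_sq hL.continuous.aestronglyMeasurable
    _ ≤ _ := by
      have e : 4 / a ^ 2 = 2 * (2 / a ^ 2) := by ring
      rw [e, mul_assoc]
      linarith

/-! ### Product measures and tensorization -/

/-- Transfers Rademacher's theorem from Lebesgue measure to the product measure. -/
theorem measure_pi_absolutelyContinuous_volume (μ : Measure ℝ) [SigmaFinite μ]
    (hμ : μ ≪ volume) : ∀ n : ℕ, Measure.pi (fun _ : Fin n => μ) ≪ volume
  | 0 => by
    rw [volume_pi, Measure.pi_of_empty, Measure.pi_of_empty]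
  | n + 1 => by
    have ih := measure_pi_absolutelyContinuous_volume μ hμ n
    have h1 := (measurePreserving_piFinSuccAbove (fun _ : Fin (n + 1) => μ) 0).symm
    have h2 := (volume_preserving_piFinSuccAbove (fun _ : Fin (n + 1) => ℝ) 0).symm
    rw [← h1.map_eq, ← h2.map_eq]
    exact (hμ.prod ih).map h1.measurable

theorem measurePreserving_fin_cons (μ : Measure ℝ) [SigmaFinite μ] (n : ℕ) :
    MeasurePreserving (fun z : ℝ × (Fin n → ℝ) => (Fin.cons z.1 z.2 : Fin (n + 1) → ℝ))
      (μ.prod (Measure.pi fun _ => μ)) (Measure.pi fun _ => μ) := by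
  convert (measurePreserving_piFinSuccAbove (fun _ : Fin (n + 1) => μ) 0).symm using 1
  funext z
  exact (Fin.insertNth_zero' z.1 z.2).symm

theorem memLp_two_pi_of_lipschitzWith {μ : Measure ℝ} [IsProbabilityMeasure μ]
    (hμ : MemLp (fun x : ℝ => x) 2 μ) {n : ℕ} {g : (Fin n → ℝ) → ℝ} {K : NNReal}
    (hg : LipschitzWith K g) : MemLp g 2 (Measure.pi fun _ : Fin n => μ) := by
  have h1 : ∀ i : Fin n, MemLp (fun x : Fin n → ℝ => |x i|) 2 (Measure.pi fun _ : Fin n => μ) :=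
    fun i => (hμ.comp_measurePreserving (measurePreserving_eval (fun _ : Fin n => μ) i)).abs
  have h1s : MemLp (fun x : Fin n → ℝ => ∑ i, |x i|) 2 (Measure.pi fun _ : Fin n => μ) :=
    memLp_finsetSum _ fun i _ => h1 i
  have h2 : MemLp (fun x : Fin n → ℝ => |g 0| + K * ∑ i, |x i|) 2
      (Measure.pi fun _ : Fin n => μ) :=
    (memLp_const |g 0|).add (h1s.const_mul (K : ℝ))
  refine h2.mono' hg.continuous.aestronglyMeasurable (ae_of_all _ fun x => ?_)
  have h3 : ‖g x - g 0‖ ≤ K * ‖x‖ := by simpa [dist_eq_norm] using hg.dist_le_mul x 0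
  have h4 : ‖x‖ ≤ ∑ i, |x i| := (pi_norm_le_iff_of_nonneg (by positivity)).2 fun i =>
    Finset.single_le_sum (f := fun i => |x i|) (fun _ _ => abs_nonneg _) (Finset.mem_univ i)
  have h5 : ‖g x‖ ≤ ‖g 0‖ + ‖g x - g 0‖ := norm_le_insert' _ _
  calc ‖g x‖ ≤ ‖g 0‖ + K * ‖x‖ := by linarith
    _ ≤ _ := by rw [Real.norm_eq_abs]; gcongr

theorem integrable_sq_mul_lineDeriv_sq {μ : Measure ℝ} [IsProbabilityMeasure μ]
    (hμ : MemLp (fun x : ℝ => x) 2 μ) {n : ℕ} {g : (Fin n → ℝ) → ℝ} {K : NNReal}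
    (hg : LipschitzWith K g) (i : Fin n) (v : Fin n → ℝ) :
    Integrable (fun x : Fin n → ℝ => x i ^ 2 * lineDeriv ℝ g x v ^ 2)
      (Measure.pi fun _ : Fin n => μ) := by
  have h1 : MemLp (fun x : Fin n → ℝ => x i) 2 (Measure.pi fun _ : Fin n => μ) :=
    hμ.comp_measurePreserving (measurePreserving_eval (fun _ : Fin n => μ) i)
  refine (h1.integrable_sq.mul_const ((K * ‖v‖) ^ 2)).mono'
    (((measurable_pi_apply i).pow_const 2).mul
      ((measurable_lineDeriv hg.continuous).pow_const 2)).aestronglyMeasurable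
    (ae_of_all _ fun x => ?_)
  rw [Real.norm_of_nonneg (by positivity)]
  refine mul_le_mul_of_nonneg_left ?_ (sq_nonneg _)
  rw [← sq_abs]
  exact pow_le_pow_left₀ (abs_nonneg _) (norm_lineDeriv_le_of_lipschitz ℝ hg) 2

theorem lineDeriv_fin_cons_zero {n : ℕ} (g : (Fin (n + 1) → ℝ) → ℝ) (x : ℝ) (y : Fin n → ℝ) :
    lineDeriv ℝ g (Fin.cons x y) (Pi.single 0 1) =
      deriv (fun x => g (Fin.cons x y)) x := by
  have h : (fun t : ℝ => g (Fin.cons x y + t • Pi.single 0 1)) =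
      fun t => (fun x => g (Fin.cons x y)) (x + t) := by
    ext t
    congr 1
    ext j
    refine Fin.cases ?_ (fun j => ?_) j <;> simp
  rw [lineDeriv, h, deriv_comp_const_add (fun x => g (Fin.cons x y)) x 0, add_zero]

theorem lineDeriv_fin_cons_succ {n : ℕ} (g : (Fin (n + 1) → ℝ) → ℝ) (x : ℝ) (y : Fin n → ℝ)
    (i : Fin n) :
    lineDeriv ℝ g (Fin.cons x y) (Pi.single i.succ 1) =
      lineDeriv ℝ (fun y => g (Fin.cons x y)) y (Pi.single i 1) := by
  have h : (fun t : ℝ => g (Fin.cons x y + t • Pi.single i.succ 1)) =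
      fun t => g (Fin.cons x (y + t • Pi.single i 1)) := by
    ext t
    congr 1
    ext j
    refine Fin.cases ?_ (fun j => ?_) j
    · simp
    · simp [Pi.single_apply]
  rw [lineDeriv, h, lineDeriv]

theorem lipschitzWith_fin_cons_left {n : ℕ} (y : Fin n → ℝ) :
    LipschitzWith 1 (fun x : ℝ => (Fin.cons x y : Fin (n + 1) → ℝ)) := by
  refine LipschitzWith.of_dist_le_mul fun x x' => ?_
  rw [NNReal.coe_one, one_mul, dist_pi_le_iff dist_nonneg]
  intro j
  refine Fin.cases ?_ (fun j => ?_) j <;> simp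

theorem lipschitzWith_fin_cons_right {n : ℕ} (x : ℝ) :
    LipschitzWith 1 (fun y : Fin n → ℝ => (Fin.cons x y : Fin (n + 1) → ℝ)) := by
  refine LipschitzWith.of_dist_le_mul fun y y' => ?_
  rw [NNReal.coe_one, one_mul, dist_pi_le_iff dist_nonneg]
  intro j
  refine Fin.cases ?_ (fun j => ?_) j
  · simp
  · simpa using dist_le_pi_dist y y' j

/-- A weighted Poincaré inequality for Lipschitz functions on the line tensorizes. -/
theorem variance_pi_le_of_variance_le {μ : Measure ℝ} [IsProbabilityMeasure μ]
    (hμ : MemLp (fun x : ℝ => x) 2 μ) {c : ℝ}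
    (hP : ∀ (K : NNReal) (g : ℝ → ℝ), LipschitzWith K g →
      Var[g; μ] ≤ c * ∫ x, x ^ 2 * deriv g x ^ 2 ∂μ) {K : NNReal} :
    ∀ (n : ℕ) (g : (Fin n → ℝ) → ℝ), LipschitzWith K g →
      Var[g; Measure.pi fun _ : Fin n => μ] ≤
        c * ∑ i, ∫ x : Fin n → ℝ, x i ^ 2 * lineDeriv ℝ g x (Pi.single i 1) ^ 2
          ∂(Measure.pi fun _ : Fin n => μ)
  | 0, g, hg => by
    rw [Measure.pi_of_empty, variance_dirac]
    simp
  | n + 1, g, hg => by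
    set ν := Measure.pi fun _ : Fin n => μ with hν
    -- Splitting off the first coordinate, Efron–Stein reduces the bound to `hP` on one factor and
    -- the induction hypothesis on the other. It only adds the two, so c does not grow.
    set E : ℝ × (Fin n → ℝ) → Fin (n + 1) → ℝ := fun z => Fin.cons z.1 z.2 with hE
    have hEm : MeasurePreserving E (μ.prod ν) (Measure.pi fun _ => μ) :=
      measurePreserving_fin_cons μ n
    have hgm : MemLp g 2 (Measure.pi fun _ : Fin (n + 1) => μ) :=
      memLp_two_pi_of_lipschitzWith hμ hg
    have hF : MemLp (fun z => g (E z)) 2 (μ.prod ν) := hgm.comp_measurePreserving hEm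
    set D : Fin (n + 1) → (Fin (n + 1) → ℝ) → ℝ :=
      fun i x => x i ^ 2 * lineDeriv ℝ g x (Pi.single i 1) ^ 2 with hD
    have hDi : ∀ i, Integrable (D i) (Measure.pi fun _ => μ) := fun i =>
      integrable_sq_mul_lineDeriv_sq hμ hg i _
    have hDE : ∀ i, Integrable (fun z => D i (E z)) (μ.prod ν) := fun i =>
      hEm.integrable_comp_of_integrable (hDi i)
    have hDint : ∀ i, ∫ x, D i x ∂(Measure.pi fun _ => μ) = ∫ z, D i (E z) ∂(μ.prod ν) :=
        fun i => by
      rw [← hEm.map_eq, integral_map hEm.aemeasurable]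
      rw [hEm.map_eq]
      exact (hDi i).1
    have hs0 : ∀ y, Var[fun x => g (E (x, y)); μ] ≤ c * ∫ x, D 0 (E (x, y)) ∂μ := fun y => by
      have := hP _ _ (hg.comp (lipschitzWith_fin_cons_left y))
      simpa only [hD, hE, Fin.cons_zero, lineDeriv_fin_cons_zero, Function.comp_def] using this
    have hs1 : ∀ x, Var[fun y => g (E (x, y)); ν] ≤
        c * ∑ i : Fin n, ∫ y, D i.succ (E (x, y)) ∂ν := fun x => by
      have hl : LipschitzWith K (fun y => g (E (x, y))) := by
        simpa [Function.comp_def] using hg.comp (lipschitzWith_fin_cons_right x)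
      have := variance_pi_le_of_variance_le hμ hP n _ hl
      simpa only [hD, hE, Fin.cons_succ, lineDeriv_fin_cons_succ] using this
    have hFs : MemLp (fun z : (Fin n → ℝ) × ℝ => g (E z.swap)) 2 (ν.prod μ) :=
      hF.comp_measurePreserving Measure.measurePreserving_swap
    have j0 := (memLp_and_integral_variance_section hFs).2.1
    have j1 := (memLp_and_integral_variance_section hF).2.1
    have k1 : ∀ i : Fin n, Integrable (fun x => ∫ y, D i.succ (E (x, y)) ∂ν) μ := fun i =>
      (hDE i.succ).integral_prod_left
    calc Var[g; Measure.pi fun _ : Fin (n + 1) => μ]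
        = Var[fun z => g (E z); μ.prod ν] :=
          (hEm.variance_fun_comp hgm.aemeasurable).symm
      _ ≤ ∫ y, Var[fun x => g (E (x, y)); μ] ∂ν + ∫ x, Var[fun y => g (E (x, y)); ν] ∂μ :=
          variance_prod_le hF
      _ ≤ ∫ y, c * ∫ x, D 0 (E (x, y)) ∂μ ∂ν +
          ∫ x, c * ∑ i : Fin n, ∫ y, D i.succ (E (x, y)) ∂ν ∂μ := by
          refine add_le_add (integral_mono j0 ((hDE 0).integral_prod_right.const_mul c) hs0)
            (integral_mono j1 ((integrable_finsetSum _ fun i _ => k1 i).const_mul c) hs1)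
      _ = c * ∑ i, ∫ x, D i x ∂(Measure.pi fun _ => μ) := by
          rw [integral_const_mul, integral_const_mul, integral_finsetSum _ fun i _ => k1 i,
            Fin.sum_univ_succ, mul_add]
          simp only [hDint]
          rw [integral_prod_symm _ (hDE 0)]
          congr 2
          exact Finset.sum_congr rfl fun i _ => (integral_prod _ (hDE i.succ)).symm

/-! ### Upper bound for Euclidean Lipschitz functions -/

/-- The partial derivatives of a `1`-Lipschitz function on Euclidean space, viewed on `Fin n → ℝ`,
have square sum at most `1` at differentiability points. -/
theorem sum_lineDeriv_sq_le_one {n : ℕ} {f : EuclideanSpace ℝ (Fin n) → ℝ}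
    (hf : LipschitzWith 1 f) {x : Fin n → ℝ}
    (hx : DifferentiableAt ℝ (fun x : Fin n → ℝ => f (WithLp.toLp 2 x)) x) :
    ∑ i, lineDeriv ℝ (fun x : Fin n → ℝ => f (WithLp.toLp 2 x)) x (Pi.single i 1) ^ 2 ≤ 1 := by
  set g : (Fin n → ℝ) → ℝ := fun x => f (WithLp.toLp 2 x) with hg
  -- Differentiating along the gradient d itself gives |d|² ≤ |d|, hence |d| ≤ 1.
  set d : Fin n → ℝ := fun i => lineDeriv ℝ g x (Pi.single i 1) with hd
  have hsum : lineDeriv ℝ g x d = ∑ i, d i ^ 2 := by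
    rw [hx.lineDeriv_eq_fderiv]
    conv_lhs => rw [← Finset.univ_sum_single d, map_sum]
    refine Finset.sum_congr rfl fun i _ => ?_
    have : (Pi.single i (d i) : Fin n → ℝ) = d i • Pi.single i 1 := by
      rw [← Pi.single_smul, smul_eq_mul, mul_one]
    rw [this, map_smul, smul_eq_mul, ← hx.lineDeriv_eq_fderiv, sq]
  have hle : ‖lineDeriv ℝ f (WithLp.toLp 2 x) (WithLp.toLp 2 d)‖ ≤
      (1 : NNReal) * ‖(WithLp.toLp 2 d : EuclideanSpace ℝ (Fin n))‖ :=
    norm_lineDeriv_le_of_lipschitz ℝ hf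
  have heq : lineDeriv ℝ f (WithLp.toLp 2 x) (WithLp.toLp 2 d) = lineDeriv ℝ g x d := rfl
  have hS : 0 ≤ ∑ i, d i ^ 2 := Finset.sum_nonneg fun _ _ => sq_nonneg _
  rw [heq, hsum, EuclideanSpace.norm_eq, Real.norm_of_nonneg hS, NNReal.coe_one, one_mul] at hle
  simp only [Real.norm_eq_abs, sq_abs] at hle
  have h2 := Real.sq_sqrt hS
  have h3 := Real.sqrt_nonneg (∑ i, d i ^ 2)
  change ∑ i, d i ^ 2 ≤ 1
  nlinarith

/-- `Fin n → ℝ` carries the sup norm, so K may depend on n. This is harmless: K serves integrability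
and differentiability and does not enter the variance bound. -/
theorem exists_lipschitzWith_comp_toLp {n : ℕ} {f : EuclideanSpace ℝ (Fin n) → ℝ}
    (hf : LipschitzWith 1 f) :
    ∃ K, LipschitzWith K (fun x : Fin n → ℝ => f (WithLp.toLp 2 x)) :=
  ⟨_, hf.comp (EuclideanSpace.equiv (Fin n) ℝ).symm.toContinuousLinearMap.lipschitz⟩

theorem measurePreserving_toLp_paretoProd (lam : ℝ) (n : ℕ) :
    MeasurePreserving (WithLp.toLp 2) (Measure.pi fun _ : Fin n => paretoMeasure 1 (lam - 1))
      (paretoProd lam n) :=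
  ⟨by fun_prop, rfl⟩

theorem memLp_paretoProd_of_lipschitzWith {lam : ℝ} (hlam : 3 < lam) {n : ℕ}
    {f : EuclideanSpace ℝ (Fin n) → ℝ} (hf : LipschitzWith 1 f) :
    MemLp f 2 (paretoProd lam n) := by
  have := isProbabilityMeasure_paretoMeasure one_pos (show 0 < lam - 1 by linarith)
  obtain ⟨K, hK⟩ := exists_lipschitzWith_comp_toLp hf
  rw [paretoProd]
  exact (memLp_map_measure_iff hf.continuous.aestronglyMeasurable (by fun_prop)).2
    (memLp_two_pi_of_lipschitzWith (memLp_id_paretoMeasure_one (by linarith)) hK)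

theorem variance_paretoProd_le {lam : ℝ} (hlam : 3 < lam) {n : ℕ} (hn : 1 ≤ n)
    {f : EuclideanSpace ℝ (Fin n) → ℝ} (hf : LipschitzWith 1 f) :
    variance f (paretoProd lam n) ≤
      4 / ((lam - 1) * (lam - 3)) * (n : ℝ) ^ (2 / (lam - 1)) := by
  obtain ⟨a, rfl⟩ : ∃ a, lam = a + 1 := ⟨lam - 1, by ring⟩
  have hT := measurePreserving_toLp_paretoProd (a + 1) n
  have e3 : a + 1 - 3 = a - 2 := by ring
  rw [add_sub_cancel_right] at hT ⊢
  rw [e3]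
  have ha : 2 < a := by linarith
  have ha0 : 0 < a := by linarith
  have := isProbabilityMeasure_paretoMeasure one_pos ha0
  obtain ⟨K, hK⟩ := exists_lipschitzWith_comp_toLp hf
  have hμ := memLp_id_paretoMeasure_one ha
  rw [← hT.variance_fun_comp hf.continuous.aemeasurable]
  set g : (Fin n → ℝ) → ℝ := fun x => f (WithLp.toLp 2 x) with hg
  set μ := paretoMeasure 1 a with hμdef
  -- This level makes s² and n s^(2-a) both equal to n^(2/a).
  set s : ℝ := (n : ℝ) ^ (1 / a) with hs
  have hn1 : (1 : ℝ) ≤ n := by exact_mod_cast hn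
  have hn0 : (0 : ℝ) < n := by linarith
  have hs1 : 1 ≤ s := Real.one_le_rpow hn1 (by positivity)
  have hP := variance_pi_le_of_variance_le (c := 4 / a ^ 2) hμ
    (fun K g hg => variance_paretoMeasure_one_le ha hg) n g hK
  have hint := fun i : Fin n => integrable_sq_mul_lineDeriv_sq hμ hK i (Pi.single i 1)
  have hae : ∀ᵐ x ∂(Measure.pi fun _ : Fin n => μ), DifferentiableAt ℝ g x :=
    measure_pi_absolutelyContinuous_volume μ (paretoMeasure_absolutelyContinuous 1 a) n
      hK.ae_differentiableAt
  have hmax : Integrable (fun t : ℝ => max (t ^ 2 - s ^ 2) 0) μ :=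
    (hμ.integrable_sq.sub (integrable_const _)).pos_part
  have hmaxi : ∀ i : Fin n, Integrable (fun x : Fin n → ℝ => max (x i ^ 2 - s ^ 2) 0)
      (Measure.pi fun _ : Fin n => μ) := fun i =>
    (measurePreserving_eval (fun _ : Fin n => μ) i).integrable_comp_of_integrable hmax
  have hmaxv : ∀ i : Fin n, ∫ x : Fin n → ℝ, max (x i ^ 2 - s ^ 2) 0
      ∂(Measure.pi fun _ : Fin n => μ) = 2 * s ^ (2 - a) / (a - 2) := fun i => by
    rw [← integral_sq_sub_sq_pos_part_paretoMeasure_one ha hs1]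
    have := measurePreserving_eval (fun _ : Fin n => μ) i
    have h := integral_map (f := fun t : ℝ => max (t ^ 2 - s ^ 2) 0) this.aemeasurable
      (by fun_prop)
    rw [this.map_eq] at h
    exact h.symm
  have hbound : ∑ i, ∫ x : Fin n → ℝ, x i ^ 2 * lineDeriv ℝ g x (Pi.single i 1) ^ 2
      ∂(Measure.pi fun _ : Fin n => μ) ≤ s ^ 2 + n * (2 * s ^ (2 - a) / (a - 2)) := by
    rw [← integral_finsetSum _ fun i _ => hint i]
    have hr : ∫ x : Fin n → ℝ, (s ^ 2 + ∑ i, max (x i ^ 2 - s ^ 2) 0)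
        ∂(Measure.pi fun _ : Fin n => μ) = s ^ 2 + n * (2 * s ^ (2 - a) / (a - 2)) := by
      rw [integral_add (integrable_const _) (integrable_finsetSum _ fun i _ => hmaxi i),
        integral_finsetSum _ fun i _ => hmaxi i]
      simp [hmaxv]
    rw [← hr]
    refine integral_mono_ae (integrable_finsetSum _ fun i _ => hint i)
      ((integrable_const _).add (integrable_finsetSum _ fun i _ => hmaxi i)) ?_
    filter_upwards [hae] with x hx
    have h1 := sum_lineDeriv_sq_le_one hf hx
    have hd : ∀ i, lineDeriv ℝ g x (Pi.single i 1) ^ 2 ≤ 1 := fun i =>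
      (Finset.single_le_sum (f := fun i => lineDeriv ℝ g x (Pi.single i 1) ^ 2)
        (fun _ _ => sq_nonneg _) (Finset.mem_univ i)).trans h1
    calc ∑ i, x i ^ 2 * lineDeriv ℝ g x (Pi.single i 1) ^ 2
        ≤ ∑ i, (s ^ 2 * lineDeriv ℝ g x (Pi.single i 1) ^ 2 + max (x i ^ 2 - s ^ 2) 0) := by
          refine Finset.sum_le_sum fun i _ => ?_
          have hp := le_max_left (x i ^ 2 - s ^ 2) 0
          have hp0 := le_max_right (x i ^ 2 - s ^ 2) 0
          -- Each squared partial derivative is at most 1, so the excess (xᵢ² - s²)₊ can be kept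
          -- without its weight.
          nlinarith [hd i, sq_nonneg (lineDeriv ℝ g x (Pi.single i 1))]
      _ ≤ _ := by
          rw [Finset.sum_add_distrib, ← Finset.mul_sum]
          gcongr
          nlinarith [sq_nonneg s]
  have es : s ^ 2 = (n : ℝ) ^ (2 / a) := by
    rw [hs, ← Real.rpow_natCast, ← Real.rpow_mul hn0.le]
    congr 1; push_cast; ring
  have es2 : n * s ^ (2 - a) = (n : ℝ) ^ (2 / a) := by
    rw [hs, ← Real.rpow_mul hn0.le]
    conv_lhs => rw [← Real.rpow_one (n : ℝ), ← Real.rpow_mul hn0.le, ← Real.rpow_add hn0]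
    congr 1; field_simp; ring
  have ha2 : 0 < a - 2 := by linarith
  refine (hP.trans (mul_le_mul_of_nonneg_left hbound (by positivity))).trans_eq ?_
  have : n * (2 * s ^ (2 - a) / (a - 2)) = 2 / (a - 2) * (n * s ^ (2 - a)) := by ring
  rw [this, es2, es]
  field_simp
  ring

/-! ### Comparison with the stated constant -/

theorem four_div_le_paretoConst {lam : ℝ} (hlam : 3 < lam) :
    4 / ((lam - 1) * (lam - 3)) ≤ paretoConst lam := by
  obtain ⟨a, rfl⟩ : ∃ a, lam = a + 1 := ⟨lam - 1, by ring⟩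
  have ha : 2 < a := by linarith
  have ha0 : 0 < a := by linarith
  have ha2 : 0 < a - 2 := by linarith
  have e3 : a + 1 - 3 = a - 2 := by ring
  have e4 : 6 * (a + 1) - 16 = 6 * a - 10 := by ring
  have e5 : 2 * (a + 1) - 6 = 2 * a - 4 := by ring
  rw [paretoConst, add_sub_cancel_right, e3, e4, e5]
  have l4 : Real.log 4 = 2 * Real.log 2 := by
    rw [show (4 : ℝ) = 2 ^ 2 by norm_num, Real.log_pow]; push_cast; ring
  rw [← Real.log_le_log_iff (by positivity) (by positivity),
    Real.log_div (by norm_num) (by positivity), Real.log_mul ha0.ne' ha2.ne',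
    Real.log_mul (by positivity) (by positivity), Real.log_mul (by positivity) (by positivity),
    Real.log_rpow two_pos, Real.log_rpow ha0, Real.log_rpow (by positivity),
    Real.log_div (by norm_num) ha2.ne', l4]
  have hv : 0 < (a - 2) / a := by positivity
  -- With v = (a-2)/a, the bound log u ≥ 1 - 1/u at u = 2v gives v log(2v) ≥ v - 1/2. This controls
  -- log(a-2) as a tends to 2; `key` then writes the difference of logarithms as four nonnegative
  -- terms.
  have h1 := Real.one_sub_inv_le_log_of_pos (show 0 < 2 * ((a - 2) / a) by positivity)
  rw [Real.log_mul two_ne_zero hv.ne', Real.log_div ha2.ne' ha0.ne'] at h1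
  have h2 := mul_le_mul_of_nonneg_left h1 hv.le
  have h3 : (a - 2) / a * (1 - (2 * ((a - 2) / a))⁻¹) = (a - 2) / a - 1 / 2 := by
    field_simp
  rw [h3] at h2
  have hA : 0 ≤ Real.log a := Real.log_nonneg (by linarith)
  have hl := Real.log_two_gt_d9
  have h4 : 0 ≤ (6 / (a + 1) - 2 / a) * Real.log a := by
    refine mul_nonneg ?_ hA
    rw [sub_nonneg, div_le_div_iff₀ ha0 (by linarith)]
    linarith
  have h5 : 0 ≤ (a - 2) / a * (2 * Real.log 2 + 1) := by positivity
  have key : (6 * a - 10) / a * Real.log 2 + -((2 * a - 4) / (a + 1)) * Real.log a +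
      2 / a * (2 * Real.log 2 - Real.log (a - 2)) -
      (2 * Real.log 2 - (Real.log a + Real.log (a - 2))) =
      (6 / (a + 1) - 2 / a) * Real.log a +
      ((a - 2) / a * (Real.log 2 + (Real.log (a - 2) - Real.log a)) - ((a - 2) / a - 1 / 2))
      + (a - 2) / a * (2 * Real.log 2 + 1) + (Real.log 2 - 1 / 2) := by
    field_simp
    ring
  linarith

/-! ### Lower bound from the maximum -/

theorem lipschitzWith_maxCoord {n : ℕ} (hn : 1 ≤ n) : LipschitzWith 1 (maxCoord n) := by
  have : Nonempty (Fin n) := ⟨⟨0, hn⟩⟩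
  refine LipschitzWith.of_le_add fun x y => ciSup_le fun i => ?_
  have h1 : |x i - y i| ≤ dist x y := by
    rw [dist_eq_norm]
    exact PiLp.norm_apply_le (x - y) i
  have h2 : y i ≤ maxCoord n y := le_ciSup (Set.finite_range fun i => y i).bddAbove i
  linarith [le_abs_self (x i - y i)]

theorem maxCoord_le_iff {n : ℕ} (hn : 1 ≤ n) (x : EuclideanSpace ℝ (Fin n)) (t : ℝ) :
    maxCoord n x ≤ t ↔ ∀ i, x i ≤ t := by
  have : Nonempty (Fin n) := ⟨⟨0, hn⟩⟩
  exact ciSup_le_iff (Set.finite_range fun i => x i).bddAbove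

theorem paretoProd_real_maxCoord_le {lam : ℝ} (hlam : 1 < lam) {n : ℕ} (hn : 1 ≤ n) {t : ℝ}
    (ht : 1 ≤ t) :
    (paretoProd lam n).real {x | maxCoord n x ≤ t} = (1 - t ^ (-(lam - 1))) ^ n := by
  have := isProbabilityMeasure_paretoMeasure one_pos (show 0 < lam - 1 by linarith)
  have hm : MeasurableSet {x : EuclideanSpace ℝ (Fin n) | maxCoord n x ≤ t} :=
    measurableSet_le (lipschitzWith_maxCoord hn).continuous.measurable measurable_const
  rw [paretoProd, map_measureReal_apply (by fun_prop) hm]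
  have : WithLp.toLp 2 ⁻¹' {x : EuclideanSpace ℝ (Fin n) | maxCoord n x ≤ t} =
      Set.univ.pi fun _ : Fin n => Set.Iic t := by
    ext x
    simp [maxCoord_le_iff hn, Pi.le_def]
  rw [this, measureReal_def, Measure.pi_pi, ENNReal.toReal_prod]
  simp only [← measureReal_def, paretoMeasure_one_real_Iic (show 0 < lam - 1 by linarith) ht]
  simp

/-- A random variable charging both sides of a gap has variance bounded below. -/
theorem mul_sq_le_variance_of_gap {Ω : Type*} [MeasurableSpace Ω] {P : Measure Ω}
    [IsProbabilityMeasure P] {X : Ω → ℝ} (hX : MemLp X 2 P) {s t p : ℝ} (hst : s < t)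
    (hs : p ≤ P.real {ω | X ω ≤ s}) (ht : p ≤ P.real {ω | t ≤ X ω}) :
    p * ((t - s) / 2) ^ 2 ≤ Var[X; P] := by
  have hc : 0 < (t - s) / 2 := by linarith
  have hch := meas_ge_le_variance_div_sq hX hc
  have hp : p ≤ P.real {ω | (t - s) / 2 ≤ |X ω - P[X]|} := by
    -- The mean is at distance at least (t - s)/2 from one of the two half-lines, and Chebyshev's
    -- inequality applies to that one.
    rcases le_total (P[X]) ((s + t) / 2) with h | h
    · refine ht.trans (measureReal_mono fun ω (hω : t ≤ X ω) => ?_)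
      have h3 : (t - s) / 2 ≤ X ω - P[X] := by linarith
      exact h3.trans (le_abs_self _)
    · refine hs.trans (measureReal_mono fun ω (hω : X ω ≤ s) => ?_)
      have h3 : (t - s) / 2 ≤ -(X ω - P[X]) := by linarith
      exact h3.trans (neg_le_abs _)
  have h2 : P.real {ω | (t - s) / 2 ≤ |X ω - P[X]|} ≤ Var[X; P] / ((t - s) / 2) ^ 2 :=
    ENNReal.toReal_le_of_le_ofReal (div_nonneg (variance_nonneg _ _) (sq_nonneg _)) hch
  exact (le_div_iff₀ (by positivity)).1 (hp.trans h2)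

/-- From log u ≥ 1 - 1/u: n log(1 - 1/n) ≥ -n/(n-1) ≥ -2. -/
theorem exp_neg_two_le_one_sub_inv_pow {n : ℕ} (hn : 2 ≤ n) :
    Real.exp (-2) ≤ (1 - (n : ℝ)⁻¹) ^ n := by
  have hn2 : (2 : ℝ) ≤ n := by exact_mod_cast hn
  have hn0 : (0 : ℝ) < n := by linarith
  have hn1 : (0 : ℝ) < n - 1 := by linarith
  have e : 1 - (n : ℝ)⁻¹ = (n - 1) / n := by field_simp
  have hpos : 0 < 1 - (n : ℝ)⁻¹ := by rw [e]; positivity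
  have h1 := mul_le_mul_of_nonneg_left (Real.one_sub_inv_le_log_of_pos hpos) hn0.le
  have h2 : -2 ≤ n * (1 - (1 - (n : ℝ)⁻¹)⁻¹) := by
    have : n * (1 - (1 - (n : ℝ)⁻¹)⁻¹) = -2 + (n - 2) / (n - 1) := by
      rw [e]; field_simp; ring
    rw [this]
    have : 0 ≤ ((n : ℝ) - 2) / (n - 1) := div_nonneg (by linarith) hn1.le
    linarith
  rw [← Real.le_log_iff_exp_le (by positivity), Real.log_pow]
  exact h2.trans h1

theorem exists_le_variance_maxCoord {lam : ℝ} (hlam : 3 < lam) :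
    ∃ c > 0, ∀ n : ℕ, 2 ≤ n →
      c * (n : ℝ) ^ (2 / (lam - 1)) ≤ variance (maxCoord n) (paretoProd lam n) := by
  set a := lam - 1 with ha
  have ha0 : 0 < a := by linarith
  -- q bounds below the probability that the maximum is at least 2s, since (1 - 2^(-a)/n)^n ≤
  -- exp(-2^(-a)). The 4 in the witness comes from the half-gap s/2. The case n = 1 is excluded:
  -- there s = 1 and the lower event is null.
  set q : ℝ := 1 - Real.exp (-(2 : ℝ) ^ (-a)) with hq
  have hq0 : 0 < q := by
    have h : (0 : ℝ) < 2 ^ (-a) := by positivity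
    have := Real.exp_lt_one_iff.2 (show -(2 : ℝ) ^ (-a) < 0 by linarith)
    linarith
  refine ⟨min (Real.exp (-2)) q / 4, by positivity, fun n hn => ?_⟩
  have hn1 : 1 ≤ n := by omega
  have hn1' : (1 : ℝ) ≤ n := by exact_mod_cast hn1
  have hn0 : (0 : ℝ) < n := by linarith
  have := isProbabilityMeasure_paretoMeasure one_pos ha0
  have hprob : IsProbabilityMeasure (paretoProd lam n) :=
    Measure.isProbabilityMeasure_map (by fun_prop)
  set s : ℝ := (n : ℝ) ^ (1 / a) with hs
  have hs1 : 1 ≤ s := Real.one_le_rpow hn1' (by positivity)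
  have hs0 : 0 < s := by linarith
  have hsa : s ^ (-a) = (n : ℝ)⁻¹ := by
    rw [hs, ← Real.rpow_mul hn0.le, ← Real.rpow_neg_one]
    congr 1; field_simp
  have hlow := paretoProd_real_maxCoord_le (show 1 < lam by linarith) hn1 hs1
  have hhigh := paretoProd_real_maxCoord_le (show 1 < lam by linarith) hn1
    (show 1 ≤ 2 * s by linarith)
  rw [← ha] at hlow hhigh
  rw [hsa] at hlow
  rw [Real.mul_rpow two_pos.le hs0.le, hsa] at hhigh
  have hm := memLp_paretoProd_of_lipschitzWith hlam (lipschitzWith_maxCoord hn1)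
  have hupper : q ≤ (paretoProd lam n).real {x | 2 * s ≤ maxCoord n x} := by
    have hms : MeasurableSet {x : EuclideanSpace ℝ (Fin n) | maxCoord n x ≤ 2 * s} :=
      measurableSet_le (lipschitzWith_maxCoord hn1).continuous.measurable measurable_const
    have h1 := probReal_compl_eq_one_sub (μ := paretoProd lam n) hms
    have h2 : (paretoProd lam n).real {x | maxCoord n x ≤ 2 * s}ᶜ ≤
        (paretoProd lam n).real {x | 2 * s ≤ maxCoord n x} :=
      measureReal_mono fun x (hx : ¬ maxCoord n x ≤ 2 * s) => (not_le.1 hx).le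
    have h3 : (1 - (2 : ℝ) ^ (-a) * (n : ℝ)⁻¹) ^ n ≤ Real.exp (-(2 : ℝ) ^ (-a)) := by
      have h2a : (2 : ℝ) ^ (-a) ≤ 1 :=
        Real.rpow_le_one_of_one_le_of_nonpos (by norm_num) (by linarith)
      simpa [div_eq_mul_inv] using
        Real.one_sub_div_pow_le_exp_neg (n := n) (t := (2 : ℝ) ^ (-a)) (by linarith)
    linarith
  have hlower : Real.exp (-2) ≤ (paretoProd lam n).real {x | maxCoord n x ≤ s} := by
    rw [hlow]; exact exp_neg_two_le_one_sub_inv_pow hn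
  have hgap := mul_sq_le_variance_of_gap hm (show s < 2 * s by linarith)
    ((min_le_left _ q).trans hlower) ((min_le_right (Real.exp (-2)) q).trans hupper)
  have es : s ^ 2 = (n : ℝ) ^ (2 / a) := by
    rw [hs, ← Real.rpow_natCast, ← Real.rpow_mul hn0.le]
    congr 1; push_cast; ring
  rw [← es]
  refine le_trans (le_of_eq ?_) hgap
  ring

/-! ### Main theorem -/

theorem mainTheorem2 (lam : ℝ) (hlam : 3 < lam) :
    -- the variance bound, with a genuinely finite variance
    (∀ n : ℕ, 1 ≤ n → ∀ f ∈ lipOne n,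
      MemLp f 2 (paretoProd lam n) ∧
        variance f (paretoProd lam n) ≤ paretoConst lam * (n : ℝ) ^ (2 / (lam - 1))) ∧
    -- the order of the supremum, which is a supremum of a bounded set
    (∀ n : ℕ, 1 ≤ n →
      BddAbove ((fun f => variance f (paretoProd lam n)) '' lipOne n)) ∧
    (fun n : ℕ => sSup ((fun f => variance f (paretoProd lam n)) '' lipOne n))
      =Θ[atTop] (fun n : ℕ => (n : ℝ) ^ (2 / (lam - 1))) ∧
    -- the maximum function is 1-Lipschitz and already has a variance of this order
    (∀ n : ℕ, 1 ≤ n → maxCoord n ∈ lipOne n) ∧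
    (fun n : ℕ => variance (maxCoord n) (paretoProd lam n))
      =Θ[atTop] (fun n : ℕ => (n : ℝ) ^ (2 / (lam - 1))) := by
  have hub : ∀ n : ℕ, 1 ≤ n → ∀ f ∈ lipOne n,
      variance f (paretoProd lam n) ≤ paretoConst lam * (n : ℝ) ^ (2 / (lam - 1)) :=
    fun n hn f hf => (variance_paretoProd_le hlam hn hf).trans
      (mul_le_mul_of_nonneg_right (four_div_le_paretoConst hlam) (by positivity))
  have hbdd : ∀ n : ℕ, 1 ≤ n →
      BddAbove ((fun f => variance f (paretoProd lam n)) '' lipOne n) := fun n hn =>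
    ⟨_, Set.forall_mem_image.2 (hub n hn)⟩
  have hmax : ∀ n : ℕ, 1 ≤ n → maxCoord n ∈ lipOne n := fun n hn => lipschitzWith_maxCoord hn
  have hle : ∀ n : ℕ, 1 ≤ n → variance (maxCoord n) (paretoProd lam n) ≤
      sSup ((fun f => variance f (paretoProd lam n)) '' lipOne n) := fun n hn =>
    le_csSup (hbdd n hn) (Set.mem_image_of_mem _ (hmax n hn))
  have hsup : ∀ n : ℕ, 1 ≤ n → sSup ((fun f => variance f (paretoProd lam n)) '' lipOne n) ≤
      paretoConst lam * (n : ℝ) ^ (2 / (lam - 1)) := fun n hn =>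
    csSup_le ⟨_, Set.mem_image_of_mem _ (hmax n hn)⟩ (Set.forall_mem_image.2 (hub n hn))
  obtain ⟨c, hc, hlow⟩ := exists_le_variance_maxCoord hlam
  -- Any sequence between the variance of the maximum and the upper bound has the right order; this
  -- covers both the supremum and the maximum.
  have htheta : ∀ u : ℕ → ℝ,
      (∀ n, 1 ≤ n → variance (maxCoord n) (paretoProd lam n) ≤ u n) →
      (∀ n : ℕ, 1 ≤ n → u n ≤ paretoConst lam * (n : ℝ) ^ (2 / (lam - 1))) →
      u =Θ[atTop] (fun n : ℕ => (n : ℝ) ^ (2 / (lam - 1))) := fun u hu1 hu2 => by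
    constructor
    · refine IsBigO.of_bound (paretoConst lam) ?_
      filter_upwards [eventually_ge_atTop 1] with n hn
      rw [Real.norm_of_nonneg ((variance_nonneg _ _).trans (hu1 n hn)),
        Real.norm_of_nonneg (by positivity)]
      exact hu2 n hn
    · refine IsBigO.of_bound c⁻¹ ?_
      filter_upwards [eventually_ge_atTop 2] with n hn
      have hn1 : 1 ≤ n := by omega
      rw [Real.norm_of_nonneg ((variance_nonneg _ _).trans (hu1 n hn1)),
        Real.norm_of_nonneg (by positivity), ← div_eq_inv_mul, le_div_iff₀' hc]
      exact (hlow n hn).trans (hu1 n hn1)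
  exact ⟨fun n hn f hf => ⟨memLp_paretoProd_of_lipschitzWith hlam hf, hub n hn f hf⟩, hbdd,
    htheta _ hle hsup, hmax, htheta _ (fun _ _ => le_rfl) fun n hn => hub n hn _ (hmax n hn)⟩
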